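/- Throughout, vector spaces are real. A Banach lattice is a Riesz space that is complete with respect to a lattice norm, i.e. a norm with $|x|\le|y|\Rightarrow\|x\|\le\|y\|$. A Banach sequence lattice is an order ideal $Y$ of $\mathbb{R}^{\mathbb{N}}$ (a linear subspace such that $f\in\mathbb R^{\mathbb N}$, $g\in Y$ and $|f|\le|g|$ imply $f\in Y$) that contains all canonical unit sequences $e_n$ and is a Banach lattice under a norm $\|\cdot\|_Y$ and the componentwise order. Let $X$ be a Banach lattice and $Y$ a Banach sequence lattice. For $n\in\mathbb{N}$ let $\mathcal{H}_n$ be the space of continuous functions $h:\mathbb{R}^n\to\mathbb{R}$ with $h(\lambda t)=\lambda h(t)$ for all $\lambda\ge 0$ and $t\in\mathbb R^n$. For $x=(x_1,\dots,x_n)\in X^n$ let $\tau_{n,x}:\mathcal{H}_n\to X$ be Krivine's functional calculus, i.e. the unique linear map that sends the $j$-th coordinate projection to $x_j$ for $1\le j\le n$ and satisfies $\tau_{n,x}(h_1\vee h_2)=\tau_{n,x}(h_1)\vee\tau_{n,x}(h_2)$ for all $h_1,h_2\in\mathcal H_n$. Put $$\|(x_1,\dots,x_n)\|_{X^n,Y,\tau}:=\big\|\tau_{n,x}\big(\|\cdot\|_{\mathbb{R}^n,Y}\big)\big\|_X,\qquad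 \|(t_1,\dots,t_n)\|_{\mathbb{R}^n,Y}:=\|(t_1,\dots,t_n,0,0,\dots)\|_Y .$$ Let $$\ell^{\tau,Y}(X):=\Big\{(x_j)_{j\ge1}\in X^{\mathbb{N}}:\ \sup_{n}\|(x_1,\dots,x_n)\|_{X^n,Y,\tau}<\infty\Big\},\qquad \|(x_j)\|_{\ell^{\tau,Y}(X)}:=\sup_{n}\|(x_1,\dots,x_n)\|_{X^n,Y,\tau},$$ with the componentwise operations and order of $X^{\mathbb N}$, and let $\ell_0^{\tau,Y}(X)$ be the closure in $\ell^{\tau,Y}(X)$ of the set of its eventually zero sequences. **Theorem.** $\ell^{\tau,Y}(X)$ is a linear subspace and sublattice of $X^{\mathbb N}$, and it is a Banach lattice under the norm $\|\cdot\|_{\ell^{\tau,Y}(X)}$. Moreover, $\ell_0^{\tau,Y}(X)$ is a closed order ideal of $\ell^{\tau,Y}(X)$, and with the same norm and order it is a Banach lattice. -/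

import Mathlib

/-- `S`, with the linear operations and the order inherited from the Riesz space `V` and with the
norm given by `N` on `S`, is a (real) Banach lattice: a linear subspace and sublattice of `V` on
which `N` is a complete lattice norm. Values of `N` outside `S` play no role. -/
structure IsBanachLatticeOn {V : Type*} [AddCommGroup V] [Module ℝ V] [Lattice V]
    [IsOrderedAddMonoid V] [PosSMulMono ℝ V] (S : Set V) (N : V → ℝ) : Prop where
  zero_mem : (0 : V) ∈ S
  add_mem : ∀ x ∈ S, ∀ y ∈ S, x + y ∈ S
  smul_mem : ∀ (c : ℝ), ∀ x ∈ S, c • x ∈ S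
  sup_mem : ∀ x ∈ S, ∀ y ∈ S, x ⊔ y ∈ S
  inf_mem : ∀ x ∈ S, ∀ y ∈ S, x ⊓ y ∈ S
  norm_nonneg : ∀ x ∈ S, 0 ≤ N x
  eq_zero_of_norm : ∀ x ∈ S, N x = 0 → x = 0
  norm_smul : ∀ (c : ℝ), ∀ x ∈ S, N (c • x) = |c| * N x
  norm_add_le : ∀ x ∈ S, ∀ y ∈ S, N (x + y) ≤ N x + N y
  norm_le_of_abs_le : ∀ x ∈ S, ∀ y ∈ S, |x| ≤ |y| → N x ≤ N y
  complete : ∀ u : ℕ → V, (∀ k, u k ∈ S) →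
    (∀ ε > 0, ∃ K, ∀ m ≥ K, ∀ k ≥ K, N (u m - u k) < ε) →
    ∃ x ∈ S, ∀ ε > 0, ∃ K, ∀ k ≥ K, N (u k - x) < ε

/-- `I ⊆ S` is an order ideal of the Riesz space `S ⊆ V`: a solid linear subspace of `S`. -/
structure IsIdealIn {V : Type*} [AddCommGroup V] [Module ℝ V] [Lattice V]
    (S I : Set V) : Prop where
  subset : I ⊆ S
  zero_mem : (0 : V) ∈ I
  add_mem : ∀ x ∈ I, ∀ y ∈ I, x + y ∈ I
  smul_mem : ∀ (c : ℝ), ∀ x ∈ I, c • x ∈ I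
  solid : ∀ x ∈ I, ∀ y ∈ S, |y| ≤ |x| → y ∈ I

/-- The closure of `T` in `S` for the norm `N`. -/
def normClosure {V : Type*} [AddCommGroup V] (S : Set V) (N : V → ℝ) (T : Set V) : Set V :=
  {x | x ∈ S ∧ ∀ ε > 0, ∃ y ∈ T, N (x - y) < ε}

/-- A Banach sequence lattice: an ideal of the space of real sequences that contains every
canonical unit sequence and is a Banach lattice. -/
structure BanachSequenceLattice where
  carrier : Set (ℕ → ℝ)
  /-- the norm of `Y`, with irrelevant values outside `carrier` -/
  norm : (ℕ → ℝ) → ℝ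
  isBanachLatticeOn : IsBanachLatticeOn carrier norm
  mem_of_abs_le : ∀ (f : ℕ → ℝ), ∀ g ∈ carrier, |f| ≤ |g| → f ∈ carrier
  single_mem : ∀ j : ℕ, (Pi.single j 1 : ℕ → ℝ) ∈ carrier

/-- The sequence `(t₁, …, tₙ, 0, 0, …)`. -/
def extendZero {n : ℕ} (t : Fin n → ℝ) : ℕ → ℝ :=
  fun j => if h : j < n then t ⟨j, h⟩ else 0

theorem extendZero_add {n : ℕ} (s t : Fin n → ℝ) :
    extendZero (s + t) = extendZero s + extendZero t := by
  funext j
  by_cases h : j < n <;> simp [extendZero, h]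

theorem extendZero_smul {n : ℕ} (c : ℝ) (t : Fin n → ℝ) :
    extendZero (c • t) = c • extendZero t := by
  funext j
  by_cases h : j < n <;> simp [extendZero, h]

theorem extendZero_eq_sum {n : ℕ} (t : Fin n → ℝ) :
    extendZero t = ∑ i : Fin n, t i • (Pi.single (i : ℕ) 1 : ℕ → ℝ) := by
  funext j
  rw [Finset.sum_apply]
  by_cases h : j < n
  · rw [Finset.sum_eq_single (⟨j, h⟩ : Fin n)]
    · simp [extendZero, h]
    · intro b _ hb
      have : j ≠ (b : ℕ) := fun e => hb (Fin.ext e.symm)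
      simp [this]
    · simp
  · rw [Finset.sum_eq_zero]
    · simp [extendZero, h]
    · intro b _
      have : j ≠ (b : ℕ) := fun e => h (e ▸ b.2)
      simp [this]

namespace BanachSequenceLattice

theorem sum_mem_and_norm_le (Y : BanachSequenceLattice) {n : ℕ} (t : Fin n → ℝ)
    (s : Finset (Fin n)) :
    (∑ i ∈ s, t i • (Pi.single (i : ℕ) 1 : ℕ → ℝ)) ∈ Y.carrier ∧
      Y.norm (∑ i ∈ s, t i • (Pi.single (i : ℕ) 1 : ℕ → ℝ)) ≤
        ∑ i ∈ s, |t i| * Y.norm (Pi.single (i : ℕ) 1) := by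
  have H := Y.isBanachLatticeOn
  induction s using Finset.induction_on with
  | empty =>
    have h0 := H.norm_smul 0 0 H.zero_mem
    simp only [smul_zero, abs_zero, zero_mul] at h0
    simpa [h0] using H.zero_mem
  | insert a s ha ih =>
    have hm := H.smul_mem (t a) _ (Y.single_mem a)
    rw [Finset.sum_insert ha, Finset.sum_insert ha]
    refine ⟨H.add_mem _ hm _ ih.1, (H.norm_add_le _ hm _ ih.1).trans ?_⟩
    rw [H.norm_smul _ _ (Y.single_mem a)]
    linarith [ih.2]

theorem extendZero_mem (Y : BanachSequenceLattice) {n : ℕ} (t : Fin n → ℝ) :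
    extendZero t ∈ Y.carrier := by
  rw [extendZero_eq_sum]
  exact (Y.sum_mem_and_norm_le t Finset.univ).1

theorem continuous_norm_extendZero (Y : BanachSequenceLattice) (n : ℕ) :
    Continuous fun t : Fin n → ℝ => Y.norm (extendZero t) := by
  have H := Y.isBanachLatticeOn
  have key : ∀ s t : Fin n → ℝ, Y.norm (extendZero s) - Y.norm (extendZero t) ≤
      ∑ i, |s i - t i| * Y.norm (Pi.single (i : ℕ) 1) := by
    intro s t
    have h1 := H.norm_add_le _ (Y.extendZero_mem (s - t)) _ (Y.extendZero_mem t)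
    rw [← extendZero_add, sub_add_cancel] at h1
    have h2 := (Y.sum_mem_and_norm_le (s - t) Finset.univ).2
    rw [← extendZero_eq_sum] at h2
    simp only [Pi.sub_apply] at h2
    linarith
  rw [continuous_iff_continuousAt]
  intro t
  have hlim : Filter.Tendsto
      (fun s : Fin n → ℝ => ∑ i, |s i - t i| * Y.norm (Pi.single (i : ℕ) 1))
      (nhds t) (nhds 0) := by
    have hc : Continuous
        (fun s : Fin n → ℝ => ∑ i, |s i - t i| * Y.norm (Pi.single (i : ℕ) 1)) := by
      fun_prop
    simpa using hc.tendsto t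
  refine tendsto_iff_dist_tendsto_zero.2 (squeeze_zero (fun _ => dist_nonneg) (fun s => ?_) hlim)
  rw [Real.dist_eq, abs_le]
  have h3 := key t s
  simp only [abs_sub_comm (t _)] at h3
  constructor <;> linarith [key s t]

end BanachSequenceLattice

/-- The space `ℋₙ` of continuous real functions on `ℝⁿ` that are positively homogeneous of
degree one. -/
def homogeneousSpace (n : ℕ) : Submodule ℝ C(Fin n → ℝ, ℝ) where
  carrier := {h | ∀ c : ℝ, 0 ≤ c → ∀ t : Fin n → ℝ, h (c • t) = c * h t}
  zero_mem' := by
    intro c _ t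
    simp
  add_mem' := by
    intro f g hf hg c hc t
    simp [hf c hc t, hg c hc t, mul_add]
  smul_mem' := by
    intro a f hf c hc t
    simp [hf c hc t, mul_left_comm]

namespace homogeneousSpace

theorem sup_mem {n : ℕ} {f g : C(Fin n → ℝ, ℝ)} (hf : f ∈ homogeneousSpace n)
    (hg : g ∈ homogeneousSpace n) : f ⊔ g ∈ homogeneousSpace n := by
  intro c hc t
  simp only [ContinuousMap.sup_apply]
  rw [hf c hc t, hg c hc t, mul_max_of_nonneg _ _ hc]

/-- The pointwise maximum of two elements of `ℋₙ`. -/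
instance instMax (n : ℕ) : Max (homogeneousSpace n) :=
  ⟨fun f g => ⟨(f : C(Fin n → ℝ, ℝ)) ⊔ g, sup_mem f.2 g.2⟩⟩

/-- The coordinate projection `t ↦ tⱼ` as an element of `ℋₙ`. -/
def proj {n : ℕ} (j : Fin n) : homogeneousSpace n :=
  ⟨⟨fun t => t j, continuous_apply j⟩, by
    intro c _ t
    simp⟩

/-- The norm `‖·‖_{ℝⁿ,Y}`, that is `t ↦ ‖(t₁, …, tₙ, 0, …)‖_Y`, as an element of `ℋₙ`. -/
def ofNorm (Y : BanachSequenceLattice) (n : ℕ) : homogeneousSpace n :=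
  ⟨⟨fun t => Y.norm (extendZero t), Y.continuous_norm_extendZero n⟩, by
    intro c hc t
    simp only [ContinuousMap.coe_mk]
    rw [extendZero_smul, Y.isBanachLatticeOn.norm_smul c _ (Y.extendZero_mem t),
      abs_of_nonneg hc]⟩

end homogeneousSpace

section Krivine

variable {X : Type*} [NormedAddCommGroup X] [NormedSpace ℝ X] [Lattice X]

/-- The two properties that characterise the linear map `τ_{n,x} : ℋₙ → X` of Krivine's functional
calculus: it sends the `j`-th projection to `xⱼ` and preserves finite suprema. -/
def IsKrivineCalculus {n : ℕ} (x : Fin n → X) (τ : homogeneousSpace n →ₗ[ℝ] X) : Prop :=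
  (∀ j, τ (homogeneousSpace.proj j) = x j) ∧ ∀ h₁ h₂, τ (h₁ ⊔ h₂) = τ h₁ ⊔ τ h₂

open Classical in
/-- Krivine's functional calculus `τ_{n,x}`: the linear map with the two characterising
properties. (In a Banach lattice there is exactly one, by Krivine's theorem, so that the value
`0` in the other case never occurs there.) -/
noncomputable def krivine {n : ℕ} (x : Fin n → X) : homogeneousSpace n →ₗ[ℝ] X :=
  if h : ∃ τ : homogeneousSpace n →ₗ[ℝ] X, IsKrivineCalculus x τ then h.choose else 0

/-- `‖(x₁, …, xₙ)‖_{Xⁿ,Y,τ} = ‖τ_{n,x}(‖·‖_{ℝⁿ,Y})‖_X`. -/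
noncomputable def tauNorm (Y : BanachSequenceLattice) {n : ℕ} (x : Fin n → X) : ℝ :=
  ‖krivine x (homogeneousSpace.ofNorm Y n)‖

/-- The norm `‖(x₁, …, xₙ)‖_{Xⁿ,Y,τ}` of the first `n` terms of a sequence. (Sequences are indexed
from `0`. The case `n = 0` gives the value `0`, because `ℋ₀` is the zero space, so it does not
affect the supremum over `n`.) -/
noncomputable def tauPartialNorm (Y : BanachSequenceLattice) (x : ℕ → X) (n : ℕ) : ℝ :=
  tauNorm Y fun i : Fin n => x i

variable (X) in
/-- The space `ℓ^{τ,Y}(X)`. -/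
def ellTau (Y : BanachSequenceLattice) : Set (ℕ → X) :=
  {x | BddAbove (Set.range (tauPartialNorm Y x))}

/-- The norm of `ℓ^{τ,Y}(X)`. -/
noncomputable def ellTauNorm (Y : BanachSequenceLattice) (x : ℕ → X) : ℝ :=
  ⨆ n, tauPartialNorm Y x n

variable (X) in
/-- The space `ℓ₀₀^{τ,Y}(X)` of eventually zero sequences in `ℓ^{τ,Y}(X)`. -/
def ellTau00 (Y : BanachSequenceLattice) : Set (ℕ → X) :=
  {x | x ∈ ellTau X Y ∧ ∃ m, ∀ j ≥ m, x j = 0}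

variable (X) in
/-- The space `ℓ₀^{τ,Y}(X)`: the closure of `ℓ₀₀^{τ,Y}(X)` in `ℓ^{τ,Y}(X)`. -/
def ellTau0 (Y : BanachSequenceLattice) : Set (ℕ → X) :=
  normClosure (ellTau X Y) (ellTauNorm Y) (ellTau00 X Y)

end Krivine

/-! ### Stability of sup-closures under the linear operations -/

section OrderedModule

variable {V : Type*} [AddCommGroup V] [Lattice V]

/-! A linear map that preserves suprema is monotone, so Krivine's calculus turns pointwise
inequalities between homogeneous functions into inequalities in `X`. Its uniqueness yields a
substitution rule, `krivine_comp`, which expresses several tuples through one common tuple.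
Homogeneity, triangle inequality and monotonicity of `tauNorm` are then inherited from the norm of
`Y` on `ℝⁿ`, and they survive the supremum over `n`. For completeness, `mul_norm_le_tauNorm` makes
the coordinates Cauchy, and `tauNorm_le_sum` lets each partial norm pass to the coordinatewise
limit. Truncation shows that the closure of the eventually zero sequences is solid.

Since `krivine` is chosen with default `0`, existence and uniqueness of the calculus must be proved.
Pair each finite supremum of linear forms with its value at `x`. A linear form dominated by a finite
maximum of linear forms lies in their convex hull (Hahn–Banach), so pointwise order of such suprema
implies order of their values (`sublinearGraph_mono`). Differences of suprema form a Riesz space on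
which `|u| ≤ ε ∑ |tᵢ|` forces the value to be at most `ε ∑ |xᵢ|` in modulus (`latticeGraph_abs_le`).
Lattice Stone–Weierstrass on the `ℓ¹` sphere makes this space dense in `ℋₙ`, and completeness of `X`
extends the values. -/

theorem smul_sup_of_nonneg [Module ℝ V] [PosSMulMono ℝ V] {c : ℝ} (hc : 0 ≤ c) (a b : V) :
    c • (a ⊔ b) = c • a ⊔ c • b := by
  rcases hc.eq_or_lt with rfl | hc'
  · simp
  refine le_antisymm ?_ (sup_le (smul_le_smul_of_nonneg_left le_sup_left hc)
    (smul_le_smul_of_nonneg_left le_sup_right hc))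
  have key : a ⊔ b ≤ c⁻¹ • (c • a ⊔ c • b) := by
    refine sup_le ?_ ?_
    · simpa [smul_smul, hc'.ne'] using
        smul_le_smul_of_nonneg_left (le_sup_left : c • a ≤ c • a ⊔ c • b) (inv_nonneg.2 hc)
    · simpa [smul_smul, hc'.ne'] using
        smul_le_smul_of_nonneg_left (le_sup_right : c • b ≤ c • a ⊔ c • b) (inv_nonneg.2 hc)
  simpa [smul_smul, hc'.ne'] using smul_le_smul_of_nonneg_left key hc

theorem supClosure_smul_mem [Module ℝ V] [PosSMulMono ℝ V] {s : Set V} {c : ℝ} (hc : 0 ≤ c)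
    (hs : ∀ a ∈ s, c • a ∈ s) {u : V} (hu : u ∈ supClosure s) : c • u ∈ supClosure s := by
  refine (supClosure_min (t := {u | c • u ∈ supClosure s})
    (fun a ha => subset_supClosure (hs a ha)) (fun a ha b hb => ?_)) hu
  rw [Set.mem_ofPred_eq, smul_sup_of_nonneg hc]
  exact supClosed_supClosure ha hb

variable [IsOrderedAddMonoid V]

theorem supClosed_setOf_add_mem {T : Set V} (hT : SupClosed T) (v : V) :
    SupClosed {u | u + v ∈ T} := by
  intro a ha b hb
  simp only [Set.mem_ofPred_eq, sup_add] at *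
  exact hT ha hb

theorem supClosure_add_mem {s : Set V} (hs : ∀ a ∈ s, ∀ b ∈ s, a + b ∈ s) {u v : V}
    (hu : u ∈ supClosure s) (hv : v ∈ supClosure s) : u + v ∈ supClosure s := by
  have h₁ : ∀ b ∈ s, supClosure s ⊆ {u | u + b ∈ supClosure s} := fun b hb =>
    supClosure_min (fun a ha => subset_supClosure (hs a ha b hb))
      (supClosed_setOf_add_mem supClosed_supClosure b)
  have h₂ : supClosure s ⊆ {w | w + u ∈ supClosure s} :=
    supClosure_min (fun b hb => by
      rw [Set.mem_ofPred_eq, add_comm]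
      exact h₁ b hb hu) (supClosed_setOf_add_mem supClosed_supClosure u)
  rw [add_comm]
  exact h₂ hv

end OrderedModule

/-! ### The calculus on lattice-linear functions -/

section LatticeGraph

variable {X : Type*} [AddCommGroup X] [Module ℝ X] {n : ℕ}

/-- The linear form with coefficients `a`, paired with its value at `x`. -/
def linearPair (x : Fin n → X) (a : Fin n → ℝ) : ((Fin n → ℝ) → ℝ) × X :=
  (fun t => ∑ i, a i * t i, ∑ i, a i • x i)

theorem linearPair_add (x : Fin n → X) (a b : Fin n → ℝ) :
    linearPair x a + linearPair x b = linearPair x (a + b) := by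
  ext <;> simp [linearPair, add_mul, add_smul, Finset.sum_add_distrib]

theorem linearPair_smul (x : Fin n → X) (c : ℝ) (a : Fin n → ℝ) :
    c • linearPair x a = linearPair x (c • a) := by
  ext <;> simp [linearPair, Finset.mul_sum, Finset.smul_sum, mul_assoc, mul_smul]

variable [Lattice X]

/-- The finite suprema of linear forms, paired with their values at `x`. -/
def sublinearGraph (x : Fin n → X) : Set (((Fin n → ℝ) → ℝ) × X) :=
  supClosure (Set.range (linearPair x))

theorem linearPair_mem_sublinearGraph (x : Fin n → X) (a : Fin n → ℝ) :
    linearPair x a ∈ sublinearGraph x :=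
  subset_supClosure ⟨a, rfl⟩

/-- This is the part of the representation of `v` as a finite maximum that is needed to compare `v`
with a linear form, put so that it is visibly stable under suprema. -/
theorem exists_finite_linearPair {x : Fin n → X} {v : ((Fin n → ℝ) → ℝ) × X}
    (hv : v ∈ sublinearGraph x) : ∃ B : Set (Fin n → ℝ), B.Finite ∧
      (∀ b ∈ B, ∑ i, b i • x i ≤ v.2) ∧ ∀ t : Fin n → ℝ, ∃ b ∈ B, v.1 t ≤ ∑ i, b i * t i := by
  refine supClosure_min (t := {v : ((Fin n → ℝ) → ℝ) × X | ∃ B : Set (Fin n → ℝ), B.Finite ∧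
      (∀ b ∈ B, ∑ i, b i • x i ≤ v.2) ∧ ∀ t : Fin n → ℝ, ∃ b ∈ B, v.1 t ≤ ∑ i, b i * t i})
      ?_ ?_ hv
  · rintro _ ⟨a, rfl⟩
    exact ⟨{a}, Set.finite_singleton a, by simp [linearPair], by simp [linearPair]⟩
  · rintro u ⟨A, hA, hA₁, hA₂⟩ v ⟨B, hB, hB₁, hB₂⟩
    refine ⟨A ∪ B, hA.union hB, ?_, fun t => ?_⟩
    · rintro b (hb | hb)
      · exact (hA₁ b hb).trans le_sup_left
      · exact (hB₁ b hb).trans le_sup_right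
    · rcases le_total (u.1 t) (v.1 t) with h | h
      · obtain ⟨b, hb, hb'⟩ := hB₂ t
        exact ⟨b, Or.inr hb, by simpa [h] using hb'⟩
      · obtain ⟨b, hb, hb'⟩ := hA₂ t
        exact ⟨b, Or.inl hb, by simpa [h] using hb'⟩

theorem sublinearGraph_smul [PosSMulMono ℝ X] {x : Fin n → X} {c : ℝ} (hc : 0 ≤ c)
    {u : ((Fin n → ℝ) → ℝ) × X}
    (hu : u ∈ sublinearGraph x) : c • u ∈ sublinearGraph x := by
  refine supClosure_smul_mem hc ?_ hu
  rintro _ ⟨a, rfl⟩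
  exact ⟨c • a, (linearPair_smul x c a).symm⟩

variable [IsOrderedAddMonoid X]

theorem sublinearGraph_add {x : Fin n → X} {u v : ((Fin n → ℝ) → ℝ) × X}
    (hu : u ∈ sublinearGraph x) (hv : v ∈ sublinearGraph x) : u + v ∈ sublinearGraph x := by
  refine supClosure_add_mem ?_ hu hv
  rintro _ ⟨a, rfl⟩ _ ⟨b, rfl⟩
  exact ⟨a + b, (linearPair_add x a b).symm⟩

variable [PosSMulMono ℝ X]

/-- The Riesz subspace generated by the coordinate forms, paired with their values at `x`. -/
def latticeGraph (x : Fin n → X) : Submodule ℝ (((Fin n → ℝ) → ℝ) × X) where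
  carrier := {u | ∃ p ∈ sublinearGraph x, ∃ q ∈ sublinearGraph x, u = p - q}
  zero_mem' := ⟨_, linearPair_mem_sublinearGraph x 0, _, linearPair_mem_sublinearGraph x 0, by simp⟩
  add_mem' := by
    rintro _ _ ⟨p, hp, q, hq, rfl⟩ ⟨p', hp', q', hq', rfl⟩
    exact ⟨p + p', sublinearGraph_add hp hp', q + q', sublinearGraph_add hq hq', by abel⟩
  smul_mem' := by
    rintro c _ ⟨p, hp, q, hq, rfl⟩
    rcases le_total 0 c with hc | hc
    · exact ⟨_, sublinearGraph_smul hc hp, _, sublinearGraph_smul hc hq, smul_sub _ _ _⟩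
    · exact ⟨_, sublinearGraph_smul (neg_nonneg.2 hc) hq, _,
        sublinearGraph_smul (neg_nonneg.2 hc) hp, by simp [sub_eq_add_neg, add_comm]⟩

theorem sublinearGraph_subset_latticeGraph (x : Fin n → X) {u : ((Fin n → ℝ) → ℝ) × X}
    (hu : u ∈ sublinearGraph x) : u ∈ latticeGraph x :=
  ⟨u, hu, _, linearPair_mem_sublinearGraph x 0, by ext <;> simp [linearPair]⟩

theorem latticeGraph_sup {x : Fin n → X} {u v : ((Fin n → ℝ) → ℝ) × X}
    (hu : u ∈ latticeGraph x) (hv : v ∈ latticeGraph x) : u ⊔ v ∈ latticeGraph x := by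
  obtain ⟨p, hp, q, hq, rfl⟩ := hu
  obtain ⟨p', hp', q', hq', rfl⟩ := hv
  -- Translate both differences by `q + q'`; translation commutes with suprema.
  refine ⟨(p + q') ⊔ (p' + q), supClosed_supClosure (sublinearGraph_add hp hq')
    (sublinearGraph_add hp' hq), q + q', sublinearGraph_add hq hq', ?_⟩
  rw [sub_eq_add_neg ((p + q') ⊔ (p' + q)), sup_add]
  congr 1 <;> abel

theorem latticeGraph_inf {x : Fin n → X} {u v : ((Fin n → ℝ) → ℝ) × X}
    (hu : u ∈ latticeGraph x) (hv : v ∈ latticeGraph x) : u ⊓ v ∈ latticeGraph x := by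
  have h := neg_mem (latticeGraph_sup (neg_mem hu) (neg_mem hv))
  rwa [neg_sup, neg_neg, neg_neg] at h

theorem latticeGraph_abs {x : Fin n → X} {u : ((Fin n → ℝ) → ℝ) × X}
    (hu : u ∈ latticeGraph x) : |u| ∈ latticeGraph x :=
  latticeGraph_sup hu (neg_mem hu)

theorem coord_mem_latticeGraph (x : Fin n → X) (j : Fin n) :
    ((fun t : Fin n → ℝ => t j), x j) ∈ latticeGraph x := by
  have h := sublinearGraph_subset_latticeGraph x (linearPair_mem_sublinearGraph x (Pi.single j 1))
  convert h using 1
  ext <;> simp [linearPair, Pi.single_apply]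

theorem sum_abs_mem_latticeGraph (x : Fin n → X) :
    ((fun t : Fin n → ℝ => ∑ i, |t i|), ∑ i, |x i|) ∈ latticeGraph x := by
  have h := sum_mem (fun i (_ : i ∈ Finset.univ) => latticeGraph_abs (coord_mem_latticeGraph x i))
  convert h using 1
  ext
  · simp [Prod.fst_sum, abs, Finset.sum_apply]
  · simp [Prod.snd_sum, abs]

/-- An element of `latticeGraph x` lies in every sup-closed, subtraction-closed set containing the
linear forms. -/
theorem latticeGraph_subset {x : Fin n → X} {T : Set (((Fin n → ℝ) → ℝ) × X)}
    (hlin : ∀ a, linearPair x a ∈ T) (hsup : SupClosed T)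
    (hsub : ∀ u ∈ T, ∀ v ∈ T, u - v ∈ T) {u : ((Fin n → ℝ) → ℝ) × X}
    (hu : u ∈ latticeGraph x) : u ∈ T := by
  obtain ⟨p, hp, q, hq, rfl⟩ := hu
  have hP : sublinearGraph x ⊆ T := supClosure_min (by rintro _ ⟨a, rfl⟩; exact hlin a) hsup
  exact hsub _ (hP hp) _ (hP hq)

theorem latticeGraph_homogeneous {x : Fin n → X} {u : ((Fin n → ℝ) → ℝ) × X}
    (hu : u ∈ latticeGraph x) {c : ℝ} (hc : 0 ≤ c) (t : Fin n → ℝ) :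
    u.1 (c • t) = c * u.1 t := by
  refine latticeGraph_subset (T := {u | u.1 (c • t) = c * u.1 t}) (fun a => ?_)
    (fun u hu v hv => ?_) (fun u hu v hv => ?_) hu
  · simp [linearPair, Finset.mul_sum, mul_left_comm]
  · simp only [Set.mem_ofPred_eq] at hu hv
    simp [hu, hv, mul_max_of_nonneg _ _ hc]
  · simp only [Set.mem_ofPred_eq] at hu hv
    simp [hu, hv, mul_sub]

/-- Otherwise a functional strictly separates `a` from the compact hull. Its coordinates form a
point `t` at which the form `a` exceeds every form in `B`. -/
theorem mem_convexHull_of_le_sup {B : Set (Fin n → ℝ)} (hB : B.Finite) {a : Fin n → ℝ}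
    (h : ∀ t : Fin n → ℝ, ∃ b ∈ B, ∑ i, a i * t i ≤ ∑ i, b i * t i) : a ∈ convexHull ℝ B := by
  by_contra ha
  obtain ⟨f, r, hf, hr⟩ := geometric_hahn_banach_closed_point (convex_convexHull ℝ B)
    (hB.isCompact_convexHull ℝ).isClosed ha
  have hrep : ∀ v : Fin n → ℝ, f v = ∑ i, v i * f (Pi.single i 1) := fun v => by
    conv_lhs => rw [pi_eq_sum_univ' v]
    simp
  obtain ⟨b, hb, hab⟩ := h fun i => f (Pi.single i 1)
  rw [← hrep, ← hrep] at hab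
  linarith [hf b (subset_convexHull ℝ B hb)]

/-- For `u` linear, its coefficients are a convex combination of those of forms whose values at `x`
are below `v.2`, and that condition is convex. Suprema on the left are then immediate. In particular
the value depends only on the function. -/
theorem sublinearGraph_mono {x : Fin n → X} {u v : ((Fin n → ℝ) → ℝ) × X}
    (hu : u ∈ sublinearGraph x) (hv : v ∈ sublinearGraph x) (h : u.1 ≤ v.1) : u.2 ≤ v.2 := by
  refine supClosure_min (t := {u : ((Fin n → ℝ) → ℝ) × X | u.1 ≤ v.1 → u.2 ≤ v.2}) ?_ ?_ hu h
  · rintro _ ⟨a, rfl⟩ ha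
    obtain ⟨B, hB, hB₁, hB₂⟩ := exists_finite_linearPair hv
    have hmem : a ∈ convexHull ℝ B := mem_convexHull_of_le_sup hB fun t => by
      obtain ⟨b, hb, hb'⟩ := hB₂ t
      exact ⟨b, hb, (ha t).trans hb'⟩
    refine convexHull_min (t := {b : Fin n → ℝ | ∑ i, b i • x i ≤ v.2}) hB₁ ?_ hmem
    intro b hb c hc r s hr hs hrs
    calc ∑ i, (r • b + s • c) i • x i = r • ∑ i, b i • x i + s • ∑ i, c i • x i := by
          simp [Finset.smul_sum, add_smul, mul_smul, Finset.sum_add_distrib]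
      _ ≤ r • v.2 + s • v.2 := add_le_add (smul_le_smul_of_nonneg_left hb hr)
          (smul_le_smul_of_nonneg_left hc hs)
      _ = v.2 := by rw [← add_smul, hrs, one_smul]
  · intro a ha b hb hab
    exact sup_le (ha (le_sup_left.trans hab)) (hb (le_sup_right.trans hab))

theorem latticeGraph_nonpos {x : Fin n → X} {u : ((Fin n → ℝ) → ℝ) × X}
    (hu : u ∈ latticeGraph x) (h : u.1 ≤ 0) : u.2 ≤ 0 := by
  obtain ⟨p, hp, q, hq, rfl⟩ := hu
  exact sub_nonpos.2 (sublinearGraph_mono hp hq (sub_nonpos.1 h))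

/-- The continuity estimate behind both existence and uniqueness of the extension to `ℋₙ`. -/
theorem latticeGraph_abs_le {x : Fin n → X} {u : ((Fin n → ℝ) → ℝ) × X}
    (hu : u ∈ latticeGraph x) {ε : ℝ} (h : ∀ t : Fin n → ℝ, |u.1 t| ≤ ε * ∑ i, |t i|) :
    |u.2| ≤ ε • ∑ i, |x i| := by
  have he := Submodule.smul_mem _ ε (sum_abs_mem_latticeGraph x)
  refine abs_le'.2 ⟨sub_nonpos.1 (latticeGraph_nonpos (sub_mem hu he) fun t => ?_),
    sub_nonpos.1 (latticeGraph_nonpos (sub_mem (neg_mem hu) he) fun t => ?_)⟩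
  · simpa using (le_abs_self _).trans (h t)
  · simpa using (neg_le_abs _).trans (h t)

end LatticeGraph

/-! ### Density of lattice-linear functions in `ℋₙ` -/

section Approximation

variable {X : Type*} [AddCommGroup X] [Module ℝ X] [Lattice X] [IsOrderedAddMonoid X]
  [PosSMulMono ℝ X] {n : ℕ}

theorem isCompact_setOf_sum_abs_eq_one (n : ℕ) : IsCompact {t : Fin n → ℝ | ∑ i, |t i| = 1} := by
  refine (isCompact_closedBall (0 : Fin n → ℝ) 1).of_isClosed_subset
    (isClosed_eq (by fun_prop) continuous_const) fun t ht => ?_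
  rw [mem_closedBall_zero_iff, pi_norm_le_iff_of_nonneg zero_le_one]
  intro i
  rw [← (show ∑ i, |t i| = 1 from ht)]
  exact Finset.single_le_sum (f := fun i => |t i|) (fun i _ => abs_nonneg _) (Finset.mem_univ i)

/-- Elements of `ℋₙ` are approximated by lattice-linear functions, uniformly on the unit sphere. -/
theorem exists_latticeGraph_approx (x : Fin n → X) (h : homogeneousSpace n) {ε : ℝ} (hε : 0 < ε) :
    ∃ u ∈ latticeGraph x, ∀ t, |h.1 t - u.1 t| ≤ ε * ∑ i, |t i| := by
  let S : Set (Fin n → ℝ) := {t | ∑ i, |t i| = 1}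
  have : CompactSpace S := isCompact_iff_compactSpace.1 (isCompact_setOf_sum_abs_eq_one n)
  let L : Set C(S, ℝ) := {φ | ∃ u ∈ latticeGraph x, ∀ s : S, φ s = u.1 s}
  have hL : closure L = ⊤ := by
    refine ContinuousMap.sublattice_closure_eq_top L ⟨0, 0, zero_mem _, fun s => rfl⟩ ?_ ?_ ?_
    · rintro f ⟨u, hu, hfu⟩ g ⟨v, hv, hgv⟩
      exact ⟨u ⊓ v, latticeGraph_inf hu hv, fun s => by simp [hfu, hgv]⟩
    · rintro f ⟨u, hu, hfu⟩ g ⟨v, hv, hgv⟩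
      exact ⟨u ⊔ v, latticeGraph_sup hu hv, fun s => by simp [hfu, hgv]⟩
    · intro v s t
      -- On the sphere, `α + β tᵢ` is lattice-linear.
      have key : ∀ (α β : ℝ) (i : Fin n), (⟨fun r : S => α + β * r.1 i,
          continuous_const.add (continuous_const.mul
            ((continuous_apply i).comp continuous_subtype_val))⟩ : C(S, ℝ)) ∈ L :=
        fun α β i => ⟨_, add_mem (Submodule.smul_mem _ α (sum_abs_mem_latticeGraph x))
          (Submodule.smul_mem _ β (coord_mem_latticeGraph x i)), fun r => by
            have hr : ∑ i, |r.1 i| = 1 := r.2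
            simp [hr]⟩
      by_cases hst : s = t
      · subst hst
        -- For `n = 0` the sphere is empty, so a point on it supplies an index.
        have hne : Nonempty (Fin n) := by
          by_contra hne
          rw [not_nonempty_iff] at hne
          have hs : ∑ i, |s.1 i| = 1 := s.2
          simp at hs
        exact ⟨_, key (v s) 0 hne.some, by simp, by simp⟩
      · obtain ⟨i, hi⟩ : ∃ i, s.1 i ≠ t.1 i := by
          by_contra! hall
          exact hst (Subtype.ext (funext hall))
        have hi' : s.1 i - t.1 i ≠ 0 := sub_ne_zero.2 hi
        -- The affine function of the `i`-th coordinate with the prescribed values at `s` and `t`.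
        refine ⟨_, key (v s - (v s - v t) / (s.1 i - t.1 i) * s.1 i)
          ((v s - v t) / (s.1 i - t.1 i)) i, by simp, ?_⟩
        simp only [ContinuousMap.coe_mk]
        field_simp
        ring
  let φ : C(S, ℝ) := ⟨fun s => h.1 s, by fun_prop⟩
  have hφ : φ ∈ closure L := hL ▸ Set.mem_univ φ
  obtain ⟨ψ, ⟨u, hu, hψ⟩, hdist⟩ := Metric.mem_closure_iff.1 hφ ε hε
  refine ⟨u, hu, fun t => ?_⟩
  have he : 0 ≤ ∑ i, |t i| := Finset.sum_nonneg fun i _ => abs_nonneg _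
  -- At the origin both functions vanish by homogeneity; any other point is rescaled to the sphere.
  rcases he.eq_or_lt with h0 | hpos
  · have ht : t = (0 : ℝ) • t := by
      funext i
      have := (Finset.sum_eq_zero_iff_of_nonneg fun i _ => abs_nonneg (t i)).1 h0.symm i
        (Finset.mem_univ i)
      simpa using this
    have h1 := h.2 0 le_rfl t
    have h2 := latticeGraph_homogeneous hu le_rfl t
    rw [← ht, zero_mul] at h1 h2
    rw [h1, h2, ← h0]
    simp
  · set e := ∑ i, |t i| with he_def
    have hs : e⁻¹ • t ∈ S := by
      change ∑ i, |e⁻¹ * t i| = 1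
      simp only [abs_mul, abs_of_pos (inv_pos.2 hpos), ← Finset.mul_sum]
      exact inv_mul_cancel₀ hpos.ne'
    have ht : t = e • e⁻¹ • t := by rw [smul_inv_smul₀ hpos.ne']
    have h1 := h.2 e he (e⁻¹ • t)
    have h2 := latticeGraph_homogeneous hu he (e⁻¹ • t)
    rw [← ht] at h1 h2
    have h3 := (ContinuousMap.dist_apply_le_dist (f := φ) (g := ψ) ⟨_, hs⟩).trans hdist.le
    rw [Real.dist_eq, hψ] at h3
    rw [h1, h2, ← mul_sub, abs_mul, abs_of_pos hpos, mul_comm]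
    exact mul_le_mul_of_nonneg_right h3 he

end Approximation

/-! ### Existence of Krivine's calculus -/

section Existence

variable {X : Type*} [NormedAddCommGroup X] [NormedSpace ℝ X]
    [Lattice X] {n : ℕ}

theorem norm_le_of_abs_le_smul_sum_abs [HasSolidNorm X] {x : Fin n → X} {y : X} {ε : ℝ} (hε : 0 ≤ ε)
    (h : |y| ≤ ε • ∑ i, |x i|) :
    ‖y‖ ≤ ε * ‖∑ i, |x i|‖ := by
  have h' := norm_le_norm_of_abs_le_abs (h.trans (le_abs_self _))
  rwa [norm_smul, Real.norm_of_nonneg hε] at h'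

variable [IsOrderedAddMonoid X] [PosSMulMono ℝ X]

/-- `y` is the value at `x` of the functional calculus for `h`: `h` and `y` are simultaneously
approximated by lattice-linear functions and their values at `x`. -/
def IsCalculusValue (x : Fin n → X) (h : (Fin n → ℝ) → ℝ) (y : X) : Prop :=
  ∀ ε > 0, ∃ u ∈ latticeGraph x, (∀ t, |h t - u.1 t| ≤ ε * ∑ i, |t i|) ∧ ‖y - u.2‖ ≤ ε

namespace IsCalculusValue

variable {x : Fin n → X} {h h' : (Fin n → ℝ) → ℝ} {y y' : X}

theorem of_mem {u : ((Fin n → ℝ) → ℝ) × X} (hu : u ∈ latticeGraph x) :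
    IsCalculusValue x u.1 u.2 := fun ε hε =>
  ⟨u, hu, fun t => by simpa using mul_nonneg hε.le (Finset.sum_nonneg fun i _ => abs_nonneg (t i)),
    by simpa using hε.le⟩

theorem add (H : IsCalculusValue x h y) (H' : IsCalculusValue x h' y') :
    IsCalculusValue x (h + h') (y + y') := by
  intro ε hε
  obtain ⟨u, hu, hu₁, hu₂⟩ := H (ε / 2) (half_pos hε)
  obtain ⟨v, hv, hv₁, hv₂⟩ := H' (ε / 2) (half_pos hε)
  refine ⟨u + v, add_mem hu hv, fun t => ?_, ?_⟩
  · have h1 : (h + h') t - (u + v).1 t = (h t - u.1 t) + (h' t - v.1 t) := by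
      simp
      ring
    rw [h1]
    linarith [abs_add_le (h t - u.1 t) (h' t - v.1 t), hu₁ t, hv₁ t]
  · have h1 : y + y' - (u + v).2 = (y - u.2) + (y' - v.2) := by
      simp
      abel
    rw [h1]
    linarith [norm_add_le (y - u.2) (y' - v.2)]

theorem smul (c : ℝ) (H : IsCalculusValue x h y) : IsCalculusValue x (c • h) (c • y) := by
  intro ε hε
  have hc : 0 < |c| + 1 := by positivity
  obtain ⟨u, hu, hu₁, hu₂⟩ := H (ε / (|c| + 1)) (div_pos hε hc)
  have hle : |c| * (ε / (|c| + 1)) ≤ ε := by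
    rw [mul_div_assoc', div_le_iff₀ hc]
    nlinarith [abs_nonneg c]
  refine ⟨c • u, Submodule.smul_mem _ c hu, fun t => ?_, ?_⟩
  · have h1 : (c • h) t - (c • u).1 t = c * (h t - u.1 t) := by
      simp [mul_sub]
    rw [h1, abs_mul]
    calc |c| * |h t - u.1 t| ≤ |c| * (ε / (|c| + 1) * ∑ i, |t i|) :=
          mul_le_mul_of_nonneg_left (hu₁ t) (abs_nonneg c)
      _ = |c| * (ε / (|c| + 1)) * ∑ i, |t i| := by ring
      _ ≤ ε * ∑ i, |t i| :=
          mul_le_mul_of_nonneg_right hle (Finset.sum_nonneg fun i _ => abs_nonneg _)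
  · rw [Prod.smul_snd, ← smul_sub, norm_smul, Real.norm_eq_abs]
    exact (mul_le_mul_of_nonneg_left hu₂ (abs_nonneg c)).trans hle

variable [HasSolidNorm X]

theorem sup (H : IsCalculusValue x h y) (H' : IsCalculusValue x h' y') :
    IsCalculusValue x (h ⊔ h') (y ⊔ y') := by
  intro ε hε
  obtain ⟨u, hu, hu₁, hu₂⟩ := H (ε / 2) (half_pos hε)
  obtain ⟨v, hv, hv₁, hv₂⟩ := H' (ε / 2) (half_pos hε)
  refine ⟨u ⊔ v, latticeGraph_sup hu hv, fun t => ?_, ?_⟩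
  · have h1 := norm_sup_sub_sup_le_add_norm (h t) (h' t) (u.1 t) (v.1 t)
    simp only [Real.norm_eq_abs] at h1
    exact h1.trans (by linarith [hu₁ t, hv₁ t])
  · exact (norm_sup_sub_sup_le_add_norm _ _ _ _).trans (by linarith)

theorem unique (H : IsCalculusValue x h y) (H' : IsCalculusValue x h y') : y = y' := by
  refine eq_of_forall_dist_le fun δ hδ => ?_
  set C := ‖∑ i, |x i|‖ with hC
  have hC0 : 0 ≤ C := norm_nonneg _
  -- With this `ε`, the errors add up to `ε + 2εC + ε = δ`.
  obtain ⟨u, hu, hu₁, hu₂⟩ := H (δ / (2 * C + 2)) (by positivity)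
  obtain ⟨v, hv, hv₁, hv₂⟩ := H' (δ / (2 * C + 2)) (by positivity)
  set ε := δ / (2 * C + 2) with hε
  have hεpos : 0 < ε := by positivity
  have hεδ : ε * (2 * C + 2) = δ := div_mul_cancel₀ _ (by positivity)
  have h1 : ‖(u - v).2‖ ≤ (2 * ε) * C := norm_le_of_abs_le_smul_sum_abs (by positivity)
    (latticeGraph_abs_le (sub_mem hu hv) fun t => by
      have h2 : (u - v).1 t = (h t - v.1 t) - (h t - u.1 t) := by simp
      rw [h2]
      linarith [abs_sub (h t - v.1 t) (h t - u.1 t), hu₁ t, hv₁ t])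
  have h3 : y - y' = (y - u.2) + (u - v).2 - (y' - v.2) := by
    simp
  rw [dist_eq_norm, h3]
  linarith [norm_sub_le ((y - u.2) + (u - v).2) (y' - v.2), norm_add_le (y - u.2) (u - v).2]

theorem exists_of_mem [CompleteSpace X] (x : Fin n → X) (h : homogeneousSpace n) :
    ∃ y, IsCalculusValue x h.1 y := by
  have hpos : ∀ k : ℕ, (0 : ℝ) < 1 / ((k : ℝ) + 1) := fun k => Nat.one_div_pos_of_nat
  choose u hu hu' using fun k : ℕ => exists_latticeGraph_approx x h (hpos k)
  set C := ‖∑ i, |x i|‖ with hC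
  have hdist : ∀ k l, ‖(u k).2 - (u l).2‖ ≤ (1 / ((k : ℝ) + 1) + 1 / ((l : ℝ) + 1)) * C := by
    intro k l
    refine norm_le_of_abs_le_smul_sum_abs (add_pos (hpos k) (hpos l)).le
      (latticeGraph_abs_le (sub_mem (hu k) (hu l)) fun t => ?_)
    have h2 : (u k - u l).1 t = (h.1 t - (u l).1 t) - (h.1 t - (u k).1 t) := by simp
    rw [h2, add_mul]
    linarith [abs_sub (h.1 t - (u l).1 t) (h.1 t - (u k).1 t), hu' k t, hu' l t]
  have hlim : Filter.Tendsto (fun k : ℕ => 1 / ((k : ℝ) + 1)) Filter.atTop (nhds 0) :=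
    tendsto_one_div_add_atTop_nhds_zero_nat
  have hcauchy : CauchySeq fun k => (u k).2 := by
    refine cauchySeq_of_le_tendsto_0 (fun N : ℕ => 2 * (1 / ((N : ℝ) + 1)) * C)
      (fun k l N hk hl => ?_) (by simpa using (hlim.const_mul 2).mul_const C)
    rw [dist_eq_norm]
    refine (hdist k l).trans (mul_le_mul_of_nonneg_right ?_ (norm_nonneg _))
    have := Nat.one_div_le_one_div (α := ℝ) hk
    have := Nat.one_div_le_one_div (α := ℝ) hl
    linarith
  obtain ⟨y, hy⟩ := cauchySeq_tendsto_of_complete hcauchy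
  refine ⟨y, fun ε hε => ?_⟩
  have h1 := (Metric.tendsto_nhds.1 hy ε hε).and (hlim.eventually (gt_mem_nhds hε))
  obtain ⟨k, hk₁, hk₂⟩ := h1.exists
  refine ⟨u k, hu k, fun t => (hu' k t).trans (mul_le_mul_of_nonneg_right hk₂.le
    (Finset.sum_nonneg fun i _ => abs_nonneg _)), ?_⟩
  rw [← dist_eq_norm, dist_comm]
  exact hk₁.le

end IsCalculusValue

variable [HasSolidNorm X]

/-- Simultaneous approximation is compatible with sums, multiples and suprema, so uniqueness of
calculus values gives every required identity. -/
theorem exists_isKrivineCalculus [CompleteSpace X] (x : Fin n → X) :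
    ∃ τ : homogeneousSpace n →ₗ[ℝ] X, IsKrivineCalculus x τ := by
  choose τ hτ using IsCalculusValue.exists_of_mem x
  refine ⟨{ toFun := τ, map_add' := fun f g => ?_, map_smul' := fun c f => ?_ }, fun j => ?_,
    fun f g => ?_⟩
  · exact (hτ (f + g)).unique ((hτ f).add (hτ g))
  · exact (hτ (c • f)).unique ((hτ f).smul c)
  · exact (hτ _).unique (.of_mem (coord_mem_latticeGraph x j))
  · exact (hτ (f ⊔ g)).unique ((hτ f).sup (hτ g))

theorem krivine_spec [CompleteSpace X] (x : Fin n → X) : IsKrivineCalculus x (krivine x) := by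
  rw [krivine, dif_pos (exists_isKrivineCalculus x)]
  exact (exists_isKrivineCalculus x).choose_spec

end Existence

/-! ### Substitution in `ℋₙ` and uniqueness of the calculus -/

namespace homogeneousSpace

variable {n m : ℕ}

/-- Composition with a family of elements of `ℋₘ`, as a linear map `ℋₙ → ℋₘ`. -/
def comp (L : Fin n → homogeneousSpace m) : homogeneousSpace n →ₗ[ℝ] homogeneousSpace m where
  toFun h := ⟨⟨fun t => h.1 fun i => (L i).1 t, by fun_prop⟩, by
    intro c hc t
    have hL : (fun i => (L i).1 (c • t)) = c • fun i => (L i).1 t :=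
      funext fun i => (L i).2 c hc t
    simp only [ContinuousMap.coe_mk]
    rw [hL, h.2 c hc]⟩
  map_add' _ _ := rfl
  map_smul' _ _ := rfl

theorem comp_proj (L : Fin n → homogeneousSpace m) (j : Fin n) : comp L (proj j) = L j :=
  rfl

theorem comp_sup (L : Fin n → homogeneousSpace m) (h₁ h₂ : homogeneousSpace n) :
    comp L (h₁ ⊔ h₂) = comp L h₁ ⊔ comp L h₂ :=
  rfl

/-- The element `t ↦ |h t|` of `ℋₙ`. -/
def absHom (h : homogeneousSpace n) : homogeneousSpace n := h ⊔ -h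

theorem absHom_apply (h : homogeneousSpace n) (t : Fin n → ℝ) : (absHom h).1 t = |h.1 t| := rfl

/-- The element `t ↦ min (f t) (g t)` of `ℋₙ`. -/
def infHom (f g : homogeneousSpace n) : homogeneousSpace n := -(-f ⊔ -g)

theorem infHom_apply (f g : homogeneousSpace n) (t : Fin n → ℝ) :
    (infHom f g).1 t = min (f.1 t) (g.1 t) := by
  change -(max (-f.1 t) (-g.1 t)) = _
  rw [max_neg_neg, neg_neg]

end homogeneousSpace

open homogeneousSpace

namespace IsKrivineCalculus

variable {X : Type*} [NormedAddCommGroup X] [NormedSpace ℝ X] [Lattice X] {n m : ℕ}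
  {x : Fin n → X} {τ τ' : homogeneousSpace n →ₗ[ℝ] X}

theorem mono (H : IsKrivineCalculus x τ) {f g : homogeneousSpace n} (h : ∀ t, f.1 t ≤ g.1 t) :
    τ f ≤ τ g := by
  have h1 : f ⊔ g = g := Subtype.ext (ContinuousMap.ext fun t => max_eq_right (h t))
  rw [← h1, H.2]
  exact le_sup_left

theorem map_absHom (H : IsKrivineCalculus x τ) (f : homogeneousSpace n) :
    τ (absHom f) = |τ f| := by
  rw [homogeneousSpace.absHom, H.2, map_neg, abs]

theorem comp {z : Fin m → X} {σ : homogeneousSpace m →ₗ[ℝ] X} (H : IsKrivineCalculus z σ)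
    (L : Fin n → homogeneousSpace m) :
    IsKrivineCalculus (fun i => σ (L i)) (σ ∘ₗ homogeneousSpace.comp L) :=
  ⟨fun j => by rw [LinearMap.comp_apply, comp_proj],
    fun h₁ h₂ => by simp only [LinearMap.comp_apply, comp_sup, H.2]⟩

variable [IsOrderedAddMonoid X]

theorem map_infHom (H : IsKrivineCalculus x τ) (f g : homogeneousSpace n) :
    τ (infHom f g) = τ f ⊓ τ g := by
  rw [homogeneousSpace.infHom, map_neg, H.2, map_neg, map_neg, neg_sup, neg_neg, neg_neg]

variable [PosSMulMono ℝ X]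

/-- On lattice-linear functions `τ` is forced by its two defining properties. Monotonicity bounds
`|τ (h - f)|` by a multiple of `∑ |xᵢ|`, so `τ` respects approximation; uniqueness follows. -/
theorem isCalculusValue (H : IsKrivineCalculus x τ) [HasSolidNorm X] (h : homogeneousSpace n) :
    IsCalculusValue x h.1 (τ h) := by
  have hG : ∀ u ∈ latticeGraph x, ∃ f : homogeneousSpace n, (∀ t, f.1 t = u.1 t) ∧ τ f = u.2 := by
    intro u hu
    refine latticeGraph_subset
      (T := {u | ∃ f : homogeneousSpace n, (∀ t, f.1 t = u.1 t) ∧ τ f = u.2}) (fun a => ?_) ?_ ?_ hu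
    · refine ⟨∑ i, a i • proj i, fun t => ?_, ?_⟩
      · simp [linearPair, proj, ContinuousMap.sum_apply]
      · simp [linearPair, H.1]
    · rintro u ⟨f, hf, hf'⟩ v ⟨g, hg, hg'⟩
      refine ⟨f ⊔ g, fun t => ?_, by rw [H.2, hf', hg']; rfl⟩
      change max (f.1 t) (g.1 t) = max (u.1 t) (v.1 t)
      rw [hf, hg]
    · rintro u ⟨f, hf, hf'⟩ v ⟨g, hg, hg'⟩
      refine ⟨f - g, fun t => ?_, by rw [map_sub, hf', hg']; rfl⟩
      change f.1 t - g.1 t = u.1 t - v.1 t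
      rw [hf, hg]
  set e : homogeneousSpace n := ∑ i, absHom (proj i) with he
  have he_apply : ∀ t, e.1 t = ∑ i, |t i| := fun t => by
    simp [he, ContinuousMap.sum_apply, absHom_apply, proj]
  have he_map : τ e = ∑ i, |x i| := by simp [he, H.map_absHom, H.1]
  intro ε hε
  set C := ‖∑ i, |x i|‖ with hC
  have hC0 : 0 ≤ C := norm_nonneg _
  -- Both this number and its product with `C` are at most `ε`, as the two error bounds require.
  have hδ : 0 < ε / (C + 1) := by positivity
  have hδε : ε / (C + 1) * (C + 1) = ε := div_mul_cancel₀ _ (by positivity)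
  obtain ⟨u, hu, hu'⟩ := exists_latticeGraph_approx x h hδ
  obtain ⟨f, hf, hf'⟩ := hG u hu
  refine ⟨u, hu, fun t => (hu' t).trans (mul_le_mul_of_nonneg_right ?_
    (Finset.sum_nonneg fun i _ => abs_nonneg _)), ?_⟩
  · nlinarith [mul_nonneg hδ.le hC0]
  · rw [← hf', ← map_sub]
    have habs : |τ (h - f)| ≤ (ε / (C + 1)) • ∑ i, |x i| := by
      rw [← H.map_absHom, ← he_map, ← map_smul]
      refine H.mono fun t => ?_
      have h2 := hu' t
      rw [← hf, ← he_apply] at h2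
      exact h2
    have h3 := norm_le_of_abs_le_smul_sum_abs hδ.le habs
    linarith

theorem unique [HasSolidNorm X] (H : IsKrivineCalculus x τ) (H' : IsKrivineCalculus x τ') :
    τ = τ' :=
  LinearMap.ext fun h => (H.isCalculusValue h).unique (H'.isCalculusValue h)

end IsKrivineCalculus

/-! ### The norm on finite tuples -/

section TauNorm

variable {X : Type*} [NormedAddCommGroup X] [NormedSpace ℝ X] [CompleteSpace X]
    [Lattice X] [IsOrderedAddMonoid X] [PosSMulMono ℝ X] [HasSolidNorm X] {n m : ℕ}

/-- As functions of `h`, both sides are Krivine calculi for `x`. -/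
theorem krivine_comp (z : Fin m → X) (L : Fin n → homogeneousSpace m) {x : Fin n → X}
    (hx : ∀ i, krivine z (L i) = x i) (h : homogeneousSpace n) :
    krivine x h = krivine z (homogeneousSpace.comp L h) := by
  obtain rfl : (fun i => krivine z (L i)) = x := funext hx
  exact LinearMap.congr_fun ((krivine_spec _).unique ((krivine_spec z).comp L)) h

variable (Y : BanachSequenceLattice)

namespace BanachSequenceLattice

theorem ofNorm_mono {s t : Fin n → ℝ} (h : ∀ i, |s i| ≤ |t i|) :
    (ofNorm Y n).1 s ≤ (ofNorm Y n).1 t := by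
  refine Y.isBanachLatticeOn.norm_le_of_abs_le _ (Y.extendZero_mem s) _ (Y.extendZero_mem t) ?_
  intro j
  by_cases hj : j < n <;> simp [extendZero, hj, h]

theorem ofNorm_add_le (s t : Fin n → ℝ) :
    (ofNorm Y n).1 (s + t) ≤ (ofNorm Y n).1 s + (ofNorm Y n).1 t := by
  have h := Y.isBanachLatticeOn.norm_add_le _ (Y.extendZero_mem s) _ (Y.extendZero_mem t)
  rwa [← extendZero_add] at h

theorem ofNorm_smul (c : ℝ) (t : Fin n → ℝ) :
    (ofNorm Y n).1 (c • t) = |c| * (ofNorm Y n).1 t := by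
  have h := Y.isBanachLatticeOn.norm_smul c _ (Y.extendZero_mem t)
  rwa [← extendZero_smul] at h

theorem ofNorm_nonneg (t : Fin n → ℝ) : 0 ≤ (ofNorm Y n).1 t :=
  Y.isBanachLatticeOn.norm_nonneg _ (Y.extendZero_mem t)

theorem ofNorm_le_sum (t : Fin n → ℝ) :
    (ofNorm Y n).1 t ≤ ∑ i, |t i| * Y.norm (Pi.single (i : ℕ) 1) := by
  have h := (Y.sum_mem_and_norm_le t Finset.univ).2
  rwa [← extendZero_eq_sum] at h

theorem norm_single_pos (j : ℕ) : 0 < Y.norm (Pi.single j 1) := by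
  refine (Y.isBanachLatticeOn.norm_nonneg _ (Y.single_mem j)).lt_of_ne' fun h => ?_
  have h1 := congrFun (Y.isBanachLatticeOn.eq_zero_of_norm _ (Y.single_mem j) h) j
  simp at h1

theorem mul_norm_single_le_ofNorm (t : Fin n → ℝ) (i : Fin n) :
    |t i| * Y.norm (Pi.single (i : ℕ) 1) ≤ (ofNorm Y n).1 t := by
  rw [← Y.isBanachLatticeOn.norm_smul _ _ (Y.single_mem i)]
  refine Y.isBanachLatticeOn.norm_le_of_abs_le _
    (Y.isBanachLatticeOn.smul_mem _ _ (Y.single_mem i)) _ (Y.extendZero_mem t) fun j => ?_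
  by_cases hj : j = i
  · subst hj
    simp [extendZero]
  · simp [hj]

end BanachSequenceLattice

open BanachSequenceLattice

theorem krivine_ofNorm_nonneg (x : Fin n → X) : 0 ≤ krivine x (ofNorm Y n) := by
  have h := (krivine_spec x).mono (f := 0) (g := ofNorm Y n) fun t => Y.ofNorm_nonneg t
  rwa [map_zero] at h

theorem tauNorm_le_of_le {x : Fin n → X} {w : X} (h : krivine x (ofNorm Y n) ≤ w) :
    tauNorm Y x ≤ ‖w‖ := by
  refine norm_le_norm_of_abs_le_abs ?_
  rw [abs_of_nonneg (krivine_ofNorm_nonneg Y x)]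
  exact h.trans (le_abs_self w)

theorem tauNorm_smul (c : ℝ) (x : Fin n → X) : tauNorm Y (c • x) = |c| * tauNorm Y x := by
  rw [tauNorm, krivine_comp x (fun i => c • proj i) (fun i => by
    rw [map_smul, (krivine_spec x).1, Pi.smul_apply])]
  have h : homogeneousSpace.comp (fun i : Fin n => c • proj i) (ofNorm Y n) =
      |c| • ofNorm Y n := Subtype.ext (ContinuousMap.ext fun t => Y.ofNorm_smul c t)
  rw [h, map_smul, norm_smul, Real.norm_eq_abs, abs_abs, tauNorm]

theorem krivine_append_castAdd (x : Fin n → X) (y : Fin m → X) (i : Fin n) :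
    krivine (Fin.append x y) (proj (Fin.castAdd m i)) = x i := by
  rw [(krivine_spec _).1, Fin.append_left]

theorem krivine_append_natAdd (x : Fin n → X) (y : Fin m → X) (i : Fin m) :
    krivine (Fin.append x y) (proj (Fin.natAdd n i)) = y i := by
  rw [(krivine_spec _).1, Fin.append_right]

/-- Over the concatenated tuple, all three values come from functions on `ℝⁿ⁺ⁿ`, where the triangle
inequality of `Y` holds pointwise. -/
theorem tauNorm_add_le (x y : Fin n → X) : tauNorm Y (x + y) ≤ tauNorm Y x + tauNorm Y y := by
  have hz := krivine_spec (Fin.append x y)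
  have hx := krivine_append_castAdd x y
  have hy := krivine_append_natAdd x y
  set z := Fin.append x y
  refine (tauNorm_le_of_le Y (w := krivine x (ofNorm Y n) + krivine y (ofNorm Y n)) ?_).trans
    (norm_add_le _ _)
  rw [krivine_comp z _ hx, krivine_comp z _ hy,
    krivine_comp z (fun i => proj (Fin.castAdd n i) + proj (Fin.natAdd n i)) (fun i => by
      rw [map_add, hx, hy, Pi.add_apply]), ← map_add]
  exact hz.mono fun t => Y.ofNorm_add_le _ _

theorem tauNorm_mono {x y : Fin n → X} (h : ∀ i, |x i| ≤ |y i|) : tauNorm Y x ≤ tauNorm Y y := by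
  have hz := krivine_spec (Fin.append x y)
  have hx := krivine_append_castAdd x y
  have hy := krivine_append_natAdd x y
  set z := Fin.append x y
  refine tauNorm_le_of_le Y ?_
  -- `‖x‖` and `‖|x|‖ = ‖|x| ⊓ |y|‖` agree.
  have h₁ : krivine x (ofNorm Y n) = krivine (fun i => |x i|) (ofNorm Y n) := by
    rw [krivine_comp x (x := fun i => |x i|) (fun i => absHom (proj i)) (fun i => by
      rw [(krivine_spec x).map_absHom, (krivine_spec x).1])]
    refine congrArg (krivine x) ?_
    refine Subtype.ext (ContinuousMap.ext fun t => le_antisymm ?_ ?_) <;>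
    exact Y.ofNorm_mono fun i => by simp [absHom_apply, proj]
  rw [h₁, krivine_comp z _ hy, krivine_comp z (fun i => infHom (absHom (proj (Fin.castAdd n i)))
    (absHom (proj (Fin.natAdd n i)))) (fun i => by
      rw [hz.map_infHom, hz.map_absHom, hz.map_absHom, hx, hy, inf_eq_left.2 (h i)])]
  refine hz.mono fun t => Y.ofNorm_mono fun i => ?_
  rw [infHom_apply, absHom_apply, absHom_apply,
    abs_of_nonneg (le_min (abs_nonneg _) (abs_nonneg _))]
  exact min_le_right _ _

theorem tauNorm_le_sum (x : Fin n → X) :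
    tauNorm Y x ≤ ∑ i : Fin n, Y.norm (Pi.single (i : ℕ) 1) * ‖x i‖ := by
  have hx := krivine_spec x
  have h1 : krivine x (ofNorm Y n) ≤ ∑ i : Fin n, Y.norm (Pi.single (i : ℕ) 1) • |x i| := by
    have h2 : ∑ i : Fin n, Y.norm (Pi.single (i : ℕ) 1) • |x i| =
        krivine x (∑ i : Fin n, Y.norm (Pi.single (i : ℕ) 1) • absHom (proj i)) := by
      simp [map_sum, hx.map_absHom, hx.1]
    rw [h2]
    refine hx.mono fun t => (Y.ofNorm_le_sum t).trans_eq ?_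
    simp [ContinuousMap.sum_apply, absHom_apply, proj, mul_comm]
  refine (tauNorm_le_of_le Y h1).trans ((norm_sum_le _ _).trans_eq ?_)
  refine Finset.sum_congr rfl fun i _ => ?_
  rw [norm_smul, norm_abs_eq_norm, Real.norm_of_nonneg (Y.norm_single_pos i).le]

theorem mul_norm_le_tauNorm (x : Fin n → X) (i : Fin n) :
    Y.norm (Pi.single (i : ℕ) 1) * ‖x i‖ ≤ tauNorm Y x := by
  have hx := krivine_spec x
  have h1 : Y.norm (Pi.single (i : ℕ) 1) • |x i| ≤ krivine x (ofNorm Y n) := by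
    rw [← hx.1 i, ← hx.map_absHom, ← map_smul]
    refine hx.mono fun t => ?_
    refine le_trans (le_of_eq ?_) (Y.mul_norm_single_le_ofNorm t i)
    simp [absHom_apply, proj, mul_comm]
  rw [← norm_abs_eq_norm (x i), ← Real.norm_of_nonneg (Y.norm_single_pos i).le, ← norm_smul]
  refine norm_le_norm_of_abs_le_abs ?_
  rw [abs_of_nonneg (smul_nonneg (Y.norm_single_pos i).le (abs_nonneg _))]
  exact h1.trans (le_abs_self _)

end TauNorm

/-! ### Solid subspaces and norm closures -/

section Ideal

variable {V : Type*} [AddCommGroup V] [Lattice V] [IsOrderedAddMonoid V]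

theorem abs_sup_le_abs_add_abs (x y : V) : |x ⊔ y| ≤ |x| + |y| := by
  refine abs_le'.2 ⟨sup_le ?_ ?_, ?_⟩
  · exact (le_abs_self x).trans (le_add_of_nonneg_right (abs_nonneg y))
  · exact (le_abs_self y).trans (le_add_of_nonneg_left (abs_nonneg x))
  · exact (neg_le_neg le_sup_left).trans
      ((neg_le_abs x).trans (le_add_of_nonneg_right (abs_nonneg y)))

theorem abs_inf_le_abs_add_abs (x y : V) : |x ⊓ y| ≤ |x| + |y| := by
  have h := abs_sup_le_abs_add_abs (-x) (-y)
  rwa [← neg_inf, abs_neg, abs_neg, abs_neg] at h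

theorem sup_mem_of_solid {I : Set V} (hadd : ∀ x ∈ I, ∀ y ∈ I, x + y ∈ I)
    (hsolid : ∀ x ∈ I, ∀ y, |y| ≤ |x| → y ∈ I) {x y : V} (hx : x ∈ I) (hy : y ∈ I) :
    x ⊔ y ∈ I :=
  hsolid _ (hadd _ (hsolid x hx |x| (abs_abs x).le) _ (hsolid y hy |y| (abs_abs y).le)) _
    ((abs_sup_le_abs_add_abs x y).trans (le_abs_self _))

theorem inf_mem_of_solid {I : Set V} (hadd : ∀ x ∈ I, ∀ y ∈ I, x + y ∈ I)
    (hsolid : ∀ x ∈ I, ∀ y, |y| ≤ |x| → y ∈ I) {x y : V} (hx : x ∈ I) (hy : y ∈ I) :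
    x ⊓ y ∈ I :=
  hsolid _ (hadd _ (hsolid x hx |x| (abs_abs x).le) _ (hsolid y hy |y| (abs_abs y).le)) _
    ((abs_inf_le_abs_add_abs x y).trans (le_abs_self _))

variable [Module ℝ V] [PosSMulMono ℝ V] {S I : Set V} {N : V → ℝ}

theorem IsBanachLatticeOn.sub_mem (H : IsBanachLatticeOn S N) {x y : V} (hx : x ∈ S)
    (hy : y ∈ S) : x - y ∈ S := by
  rw [sub_eq_add_neg, ← neg_one_smul ℝ y]
  exact H.add_mem _ hx _ (H.smul_mem _ _ hy)

theorem IsBanachLatticeOn.norm_zero (H : IsBanachLatticeOn S N) : N 0 = 0 := by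
  simpa using H.norm_smul 0 0 H.zero_mem

theorem IsBanachLatticeOn.norm_sub_le_norm_sub_add (H : IsBanachLatticeOn S N) {x y z : V}
    (hx : x ∈ S) (hy : y ∈ S) (hz : z ∈ S) : N (x - z) ≤ N (x - y) + N (y - z) := by
  have h := H.norm_add_le _ (H.sub_mem hx hy) _ (H.sub_mem hy hz)
  rwa [sub_add_sub_cancel] at h

theorem IsBanachLatticeOn.subset_normClosure (H : IsBanachLatticeOn S N) (hI : I ⊆ S) :
    I ⊆ normClosure S N I :=
  fun x hx => ⟨hI hx, fun ε hε => ⟨x, hx, by rwa [sub_self, H.norm_zero]⟩⟩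

theorem IsBanachLatticeOn.normClosure_normClosure (H : IsBanachLatticeOn S N) (hI : I ⊆ S) :
    normClosure S N (normClosure S N I) = normClosure S N I := by
  refine Set.Subset.antisymm (fun x hx => ⟨hx.1, fun ε hε => ?_⟩)
    (H.subset_normClosure fun x hx => hx.1)
  obtain ⟨y, hy, hxy⟩ := hx.2 (ε / 2) (half_pos hε)
  obtain ⟨z, hz, hyz⟩ := hy.2 (ε / 2) (half_pos hε)
  exact ⟨z, hz, by linarith [H.norm_sub_le_norm_sub_add hx.1 hy.1 (hI hz)]⟩

/-- A closed ideal of a Banach lattice that is an ideal of the ambient Riesz space is itself a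
Banach lattice. -/
theorem IsBanachLatticeOn.of_closed_ideal (H : IsBanachLatticeOn S N) (hI : IsIdealIn S I)
    (hS : ∀ x ∈ S, ∀ y, |y| ≤ |x| → y ∈ S) (hclosed : normClosure S N I = I) :
    IsBanachLatticeOn I N := by
  -- Solidity in `V`, not only in `S`, is needed because suprema and infima are formed in `V`.
  have hsolid : ∀ x ∈ I, ∀ y, |y| ≤ |x| → y ∈ I := fun x hx y hy =>
    hI.solid x hx y (hS x (hI.subset hx) y hy) hy
  exact
    { zero_mem := hI.zero_mem
      add_mem := hI.add_mem
      smul_mem := hI.smul_mem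
      sup_mem := fun x hx y hy => sup_mem_of_solid hI.add_mem hsolid hx hy
      inf_mem := fun x hx y hy => inf_mem_of_solid hI.add_mem hsolid hx hy
      norm_nonneg := fun x hx => H.norm_nonneg x (hI.subset hx)
      eq_zero_of_norm := fun x hx => H.eq_zero_of_norm x (hI.subset hx)
      norm_smul := fun c x hx => H.norm_smul c x (hI.subset hx)
      norm_add_le := fun x hx y hy => H.norm_add_le x (hI.subset hx) y (hI.subset hy)
      norm_le_of_abs_le := fun x hx y hy => H.norm_le_of_abs_le x (hI.subset hx) y (hI.subset hy)
      complete := fun u hu hcauchy => by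
        obtain ⟨x, hx, hlim⟩ := H.complete u (fun k => hI.subset (hu k)) hcauchy
        refine ⟨x, ?_, hlim⟩
        rw [← hclosed]
        refine ⟨hx, fun ε hε => ?_⟩
        obtain ⟨K, hK⟩ := hlim ε hε
        refine ⟨u K, hu K, ?_⟩
        have hmem := H.sub_mem (hI.subset (hu K)) hx
        have hneg := H.norm_smul (-1) _ hmem
        rw [neg_one_smul, neg_sub, abs_neg, abs_one, one_mul] at hneg
        rw [hneg]
        exact hK K le_rfl }

end Ideal

/-! ### The sequence spaces -/

section Sequences

variable {X : Type*} [NormedAddCommGroup X] [NormedSpace ℝ X] [Lattice X]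
  (Y : BanachSequenceLattice)

theorem tauPartialNorm_nonneg (x : ℕ → X) (n : ℕ) : 0 ≤ tauPartialNorm Y x n :=
  norm_nonneg _

variable (X) in
theorem ellTau00_subset_ellTau : ellTau00 X Y ⊆ ellTau X Y :=
  fun _ hx => hx.1

variable {Y}

theorem mem_ellTau_of_le {x : ℕ → X} {C : ℝ} (h : ∀ n, tauPartialNorm Y x n ≤ C) :
    x ∈ ellTau X Y :=
  ⟨C, by rintro _ ⟨n, rfl⟩; exact h n⟩

theorem ellTauNorm_le {x : ℕ → X} {C : ℝ} (h : ∀ n, tauPartialNorm Y x n ≤ C) :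
    ellTauNorm Y x ≤ C :=
  ciSup_le h

theorem tauPartialNorm_le_ellTauNorm {x : ℕ → X} (hx : x ∈ ellTau X Y) (n : ℕ) :
    tauPartialNorm Y x n ≤ ellTauNorm Y x :=
  le_ciSup (f := tauPartialNorm Y x) hx n

variable [CompleteSpace X] [IsOrderedAddMonoid X] [PosSMulMono ℝ X] [HasSolidNorm X]

variable (Y) in
theorem tauPartialNorm_smul (c : ℝ) (x : ℕ → X) (n : ℕ) :
    tauPartialNorm Y (c • x) n = |c| * tauPartialNorm Y x n :=
  tauNorm_smul Y c fun i : Fin n => x i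

variable (Y) in
theorem tauPartialNorm_add_le (x y : ℕ → X) (n : ℕ) :
    tauPartialNorm Y (x + y) n ≤ tauPartialNorm Y x n + tauPartialNorm Y y n :=
  tauNorm_add_le Y (fun i : Fin n => x i) fun i : Fin n => y i

theorem tauPartialNorm_mono {x y : ℕ → X} (h : |x| ≤ |y|) (n : ℕ) :
    tauPartialNorm Y x n ≤ tauPartialNorm Y y n :=
  tauNorm_mono Y fun i : Fin n => h i

theorem ellTau_solid {x y : ℕ → X} (hx : x ∈ ellTau X Y) (h : |y| ≤ |x|) : y ∈ ellTau X Y :=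
  mem_ellTau_of_le fun n => (tauPartialNorm_mono h n).trans (tauPartialNorm_le_ellTauNorm hx n)

theorem ellTau_add {x y : ℕ → X} (hx : x ∈ ellTau X Y) (hy : y ∈ ellTau X Y) :
    x + y ∈ ellTau X Y :=
  mem_ellTau_of_le fun n => (tauPartialNorm_add_le Y x y n).trans
    (add_le_add (tauPartialNorm_le_ellTauNorm hx n) (tauPartialNorm_le_ellTauNorm hy n))

theorem ellTau_smul (c : ℝ) {x : ℕ → X} (hx : x ∈ ellTau X Y) : c • x ∈ ellTau X Y :=
  mem_ellTau_of_le fun n => (tauPartialNorm_smul Y c x n).trans_le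
    (mul_le_mul_of_nonneg_left (tauPartialNorm_le_ellTauNorm hx n) (abs_nonneg c))

theorem zero_mem_ellTau : (0 : ℕ → X) ∈ ellTau X Y :=
  mem_ellTau_of_le (C := 0) fun n => by
    simpa using (tauPartialNorm_smul Y 0 (0 : ℕ → X) n).le

theorem ellTau_sub {x y : ℕ → X} (hx : x ∈ ellTau X Y) (hy : y ∈ ellTau X Y) :
    x - y ∈ ellTau X Y := by
  rw [sub_eq_add_neg, ← neg_one_smul ℝ y]
  exact ellTau_add hx (ellTau_smul _ hy)

theorem mul_norm_apply_le_ellTauNorm {x : ℕ → X} (hx : x ∈ ellTau X Y) (j : ℕ) :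
    Y.norm (Pi.single j 1) * ‖x j‖ ≤ ellTauNorm Y x :=
  (mul_norm_le_tauNorm Y (fun i : Fin (j + 1) => x i) (Fin.last j)).trans
    (tauPartialNorm_le_ellTauNorm hx (j + 1))

theorem tendsto_tauPartialNorm_sub {u : ℕ → ℕ → X} {x : ℕ → X}
    (h : ∀ j, Filter.Tendsto (fun k => u k j) Filter.atTop (nhds (x j))) (n : ℕ) :
    Filter.Tendsto (fun k => tauPartialNorm Y (u k - x) n) Filter.atTop (nhds 0) := by
  refine squeeze_zero (fun k => tauPartialNorm_nonneg Y _ n)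
    (fun k => tauNorm_le_sum Y fun i : Fin n => (u k - x) i) ?_
  have h1 : ∀ i : Fin n, Filter.Tendsto
      (fun k => Y.norm (Pi.single (i : ℕ) 1) * ‖(u k - x) i‖) Filter.atTop (nhds 0) := fun i => by
    simpa using (tendsto_iff_norm_sub_tendsto_zero.1 (h i)).const_mul
      (Y.norm (Pi.single (i : ℕ) 1))
  simpa using tendsto_finsetSum Finset.univ fun i _ => h1 i

theorem ellTau_complete (u : ℕ → ℕ → X) (hu : ∀ k, u k ∈ ellTau X Y)
    (hcauchy : ∀ ε > 0, ∃ K, ∀ m ≥ K, ∀ k ≥ K, ellTauNorm Y (u m - u k) < ε) :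
    ∃ x ∈ ellTau X Y, ∀ ε > 0, ∃ K, ∀ k ≥ K, ellTauNorm Y (u k - x) < ε := by
  have hcoord : ∀ j, CauchySeq fun k => u k j := by
    intro j
    refine Metric.cauchySeq_iff.2 fun ε hε => ?_
    have hpos := Y.norm_single_pos j
    obtain ⟨K, hK⟩ := hcauchy _ (mul_pos hpos hε)
    refine ⟨K, fun m hm k hk => ?_⟩
    rw [dist_eq_norm]
    exact lt_of_mul_lt_mul_left ((mul_norm_apply_le_ellTauNorm (ellTau_sub (hu m) (hu k)) j).trans_lt
      (hK m hm k hk)) hpos.le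
  choose x hx using fun j => cauchySeq_tendsto_of_complete (hcoord j)
  have hbound : ∀ ε > 0, ∃ K, ∀ k ≥ K, ∀ n, tauPartialNorm Y (u k - x) n ≤ ε := by
    intro ε hε
    obtain ⟨K, hK⟩ := hcauchy ε hε
    refine ⟨K, fun k hk n => ?_⟩
    have hlim := (tendsto_tauPartialNorm_sub (Y := Y) hx n).const_add ε
    rw [add_zero] at hlim
    -- Let `m → ∞` with `n` fixed; `K` does not depend on `n`, so the bound survives the supremum.
    refine ge_of_tendsto hlim (Filter.eventually_atTop.2 ⟨K, fun m hm => ?_⟩)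
    have h1 := tauPartialNorm_add_le Y (u k - u m) (u m - x) n
    rw [sub_add_sub_cancel] at h1
    have h2 := tauPartialNorm_le_ellTauNorm (ellTau_sub (hu k) (hu m)) n
    linarith [hK k hk m hm]
  refine ⟨x, ?_, fun ε hε => ?_⟩
  · obtain ⟨K, hK⟩ := hbound 1 one_pos
    -- The limit is recovered as `x = u K - (u K - x)`.
    have h1 := ellTau_sub (hu K) (mem_ellTau_of_le (hK K le_rfl))
    rwa [sub_sub_cancel] at h1
  · obtain ⟨K, hK⟩ := hbound (ε / 2) (half_pos hε)
    exact ⟨K, fun k hk => (ellTauNorm_le (hK k hk)).trans_lt (half_lt_self hε)⟩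

variable (X Y)

theorem isBanachLatticeOn_ellTau : IsBanachLatticeOn (ellTau X Y) (ellTauNorm Y) where
  zero_mem := zero_mem_ellTau
  add_mem _ hx _ hy := ellTau_add hx hy
  smul_mem c _ hx := ellTau_smul c hx
  sup_mem x hx y hy := sup_mem_of_solid (I := ellTau X Y) (fun _ hx _ hy => ellTau_add hx hy)
    (fun _ hx _ h => ellTau_solid hx h) hx hy
  inf_mem x hx y hy := inf_mem_of_solid (I := ellTau X Y) (fun _ hx _ hy => ellTau_add hx hy)
    (fun _ hx _ h => ellTau_solid hx h) hx hy
  norm_nonneg x hx := (tauPartialNorm_nonneg Y x 0).trans (tauPartialNorm_le_ellTauNorm hx 0)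
  eq_zero_of_norm x hx h := by
    funext j
    have h1 := mul_norm_apply_le_ellTauNorm hx j
    rw [h] at h1
    exact norm_le_zero_iff.1 (nonpos_of_mul_nonpos_right h1 (Y.norm_single_pos j))
  norm_smul c x _ := by
    rw [ellTauNorm, ellTauNorm, Real.mul_iSup_of_nonneg (abs_nonneg c)]
    exact iSup_congr fun n => tauPartialNorm_smul Y c x n
  norm_add_le x hx y hy := ellTauNorm_le fun n => (tauPartialNorm_add_le Y x y n).trans
    (add_le_add (tauPartialNorm_le_ellTauNorm hx n) (tauPartialNorm_le_ellTauNorm hy n))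
  norm_le_of_abs_le x _ y hy h := ellTauNorm_le fun n =>
    (tauPartialNorm_mono h n).trans (tauPartialNorm_le_ellTauNorm hy n)
  complete u hu h := ellTau_complete u hu h

theorem isIdealIn_ellTau0 : IsIdealIn (ellTau X Y) (ellTau0 X Y) := by
  have H := isBanachLatticeOn_ellTau X Y
  refine ⟨fun x hx => hx.1, H.subset_normClosure (ellTau00_subset_ellTau X Y)
    ⟨zero_mem_ellTau, 0, fun _ _ => rfl⟩, ?_, ?_, ?_⟩
  · rintro x ⟨hx, hx'⟩ y ⟨hy, hy'⟩
    refine ⟨ellTau_add hx hy, fun ε hε => ?_⟩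
    obtain ⟨v, ⟨hv, k, hk⟩, hxv⟩ := hx' (ε / 2) (half_pos hε)
    obtain ⟨w, ⟨hw, l, hl⟩, hyw⟩ := hy' (ε / 2) (half_pos hε)
    refine ⟨v + w, ⟨ellTau_add hv hw, max k l, fun j hj => ?_⟩, ?_⟩
    · simp [hk j ((le_max_left k l).trans hj), hl j ((le_max_right k l).trans hj)]
    · rw [add_sub_add_comm]
      linarith [H.norm_add_le _ (ellTau_sub hx hv) _ (ellTau_sub hy hw)]
  · rintro c x ⟨hx, hx'⟩
    refine ⟨ellTau_smul c hx, fun ε hε => ?_⟩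
    have hc : 0 < |c| + 1 := by positivity
    obtain ⟨v, ⟨hv, k, hk⟩, hxv⟩ := hx' (ε / (|c| + 1)) (div_pos hε hc)
    refine ⟨c • v, ⟨ellTau_smul c hv, k, fun j hj => by simp [hk j hj]⟩, ?_⟩
    rw [← smul_sub, H.norm_smul c _ (ellTau_sub hx hv)]
    rw [lt_div_iff₀ hc] at hxv
    nlinarith [H.norm_nonneg _ (ellTau_sub hx hv)]
  · rintro x ⟨hx, hx'⟩ y hy hxy
    refine ⟨hy, fun ε hε => ?_⟩
    obtain ⟨v, ⟨hv, k, hk⟩, hxv⟩ := hx' ε hε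
    -- Truncate `y` where `v` vanishes.
    let w : ℕ → X := fun j => if j < k then y j else 0
    have hw : w ∈ ellTau X Y := ellTau_solid hy fun j => by
      by_cases hj : j < k <;> simp [w, hj]
    refine ⟨w, ⟨hw, k, fun j hj => by simp [w, not_lt.2 hj]⟩, lt_of_le_of_lt ?_ hxv⟩
    -- Below `k` the difference `y - w` vanishes; from `k` on it is `y`, dominated by `x = x - v`.
    refine H.norm_le_of_abs_le _ (ellTau_sub hy hw) _ (ellTau_sub hx hv) fun j => ?_
    by_cases hj : j < k
    · simp [w, hj]
    · simpa [w, hj, hk j (not_lt.1 hj)] using hxy j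

end Sequences

theorem mainTheorem6 {X : Type*} [NormedAddCommGroup X] [NormedSpace ℝ X] [CompleteSpace X]
    [Lattice X] [IsOrderedAddMonoid X] [PosSMulMono ℝ X] [HasSolidNorm X]
    (Y : BanachSequenceLattice) :
    IsBanachLatticeOn (ellTau X Y) (ellTauNorm Y) ∧
    IsBanachLatticeOn (ellTau0 X Y) (ellTauNorm Y) ∧
    IsIdealIn (ellTau X Y) (ellTau0 X Y) ∧
    normClosure (ellTau X Y) (ellTauNorm Y) (ellTau0 X Y) = ellTau0 X Y := by
  have H := isBanachLatticeOn_ellTau X Y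
  have hI := isIdealIn_ellTau0 X Y
  have hclosed := H.normClosure_normClosure (ellTau00_subset_ellTau X Y)
  exact ⟨H, H.of_closed_ideal hI (fun _ hx _ h => ellTau_solid hx h) hclosed, hI, hclosed⟩
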